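/- For a finite group $G$, the generating graph $\Gamma(G)$ is the graph whose vertices are the nontrivial elements of $G$, two distinct vertices $x,y$ being adjacent if and only if $\langle x,y\rangle=G$. For $1\neq g\in G$ let $\delta(g)$ denote the degree of $g$ in $\Gamma(G)$. A graph is called Eulerian if it has a closed walk that goes through every edge exactly once. Let $n>4$ be an integer and let $G=\mathrm{Alt}_n$ or $G=\mathrm{Sym}_n$, in its natural action on $n$ points. Let $1\neq g\in G$. If $g$ belongs to no maximal subgroup of $G$ that acts primitively on the $n$ points and is not equal to $\mathrm{Alt}_n$, then $\delta(g)$ is even. In particular, if $\mathrm{Sym}_n$ and $\mathrm{Alt}_n$ are the only primitive subgroups of $\mathrm{Sym}_n$ (the only primitive groups of degree $n$), then every vertex of $\Gamma(G)$ has even degree and $\Gamma(G)$ is Eulerian. -/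

import Mathlib

/-- The generating graph `Γ(G)` of a group `G`: its vertices are the nontrivial elements of `G`,
and two vertices are adjacent iff they are distinct and together generate `G`. -/
def generatingGraph (G : Type*) [Group G] : SimpleGraph {x : G // x ≠ 1} where
  Adj x y := x ≠ y ∧ Subgroup.closure {(x : G), (y : G)} = ⊤
  symm := ⟨fun x y h => ⟨h.1.symm, by rw [Set.pair_comm]; exact h.2⟩⟩
  loopless := ⟨fun _ h => h.1 rfl⟩

/-- The degree `δ(g)` of a nontrivial element `g` of a finite group `G` in `Γ(G)`. -/
noncomputable def generatingDegree {G : Type*} [Group G] [Finite G] (g : {x : G // x ≠ 1}) : ℕ :=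
  haveI : Fintype ((generatingGraph G).neighborSet g) := Fintype.ofFinite _
  (generatingGraph G).degree g

open Classical in
/-- A graph is Eulerian if it has an Eulerian circuit: a closed walk
that goes through every edge exactly once. -/
def IsEulerianGraph {V : Type*} (Γ : SimpleGraph V) : Prop :=
  ∃ (v : V) (p : Γ.Walk v v), p.IsEulerian

/-- `M` is a maximal primitive subgroup of the permutation group `G` on `Ω`: a maximal (proper)
subgroup of `G` which acts primitively on `Ω`. -/
def IsMaximalPrimitive {Ω : Type*} (G : Subgroup (Equiv.Perm Ω)) (M : Subgroup G) : Prop :=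
  IsCoatom M ∧ MulAction.IsPreprimitive M Ω

section

open scoped Pointwise

/-! The degree δ(g) is the number of permutations x with ⟨g, x⟩ = G, and these x are paired off. If
an involution c commutes with g, conjugation by c pairs them: a fixed x would put c in the
centralizer of G ≥ Alt, which is trivial. Otherwise g has odd order and its cycles have distinct
lengths. The hypothesis on g then turns ⟨g, x⟩ = G into two conditions: x has a prescribed sign, and
⟨g, x⟩ is primitive. So x may be multiplied by an even involution whenever primitivity survives.

If the order of g is a prime power, some z in ⟨g⟩ is a power of every nontrivial element of ⟨g⟩; an
even involution h that moves points only inside cycles of z respects all nontrivial blocks, and x ↦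
xh is the pairing. Otherwise an even involution t normalizes ⟨g⟩ and keeps every cycle of g; x ↦
txt⁻¹ pairs the x not commuting with t, and x ↦ xt pairs the others. Both cases rest on
`HasDistinctCycles.exists_zpow_smul_eq`.

When Sym and Alt are the only primitive groups, the hypothesis holds for every g. Euler's theorem
then needs all edges in one component; cycles missing only one or two points serve as hubs. -/

theorem Finset.even_card_of_fixedPointFree_involution {ι : Type*} (s : Finset ι) (f : ι → ι)
    (hs : ∀ x ∈ s, f x ∈ s) (hf : ∀ x ∈ s, f (f x) = x) (hne : ∀ x ∈ s, f x ≠ x) :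
    Even s.card := by
  have h := Finset.sum_involution (s := s) (f := fun _ => (1 : ZMod 2)) (fun x _ => f x)
    (fun _ _ => by decide) (fun x hx _ => hne x hx) hs hf
  rw [Finset.sum_const, nsmul_eq_mul, mul_one] at h
  exact (ZMod.natCast_eq_zero_iff_even).1 h

/-- An involution `f` of `s`, together with a fixed point free involution `t` of the set of fixed
points of `f` in `s`, forces `s` to have even cardinality. -/
theorem Finset.even_card_of_two_involutions {ι : Type*} (s : Finset ι) (f t : ι → ι)
    (hs : ∀ x ∈ s, f x ∈ s) (hf : ∀ x ∈ s, f (f x) = x)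
    (ht : ∀ x ∈ s, f x = x → t x ∈ s ∧ f (t x) = t x) (htt : ∀ x ∈ s, f x = x → t (t x) = x)
    (hne : ∀ x ∈ s, f x = x → t x ≠ x) : Even s.card := by
  classical
  rw [← Finset.card_filter_add_card_filter_not (fun x => f x = x)]
  refine Even.add ?_ ?_
  · refine Finset.even_card_of_fixedPointFree_involution _ t ?_ ?_ ?_ <;>
      simp only [Finset.mem_filter] <;> rintro x ⟨hx, hfx⟩
    exacts [ht x hx hfx, htt x hx hfx, hne x hx hfx]
  · refine Finset.even_card_of_fixedPointFree_involution _ f ?_ ?_ ?_ <;>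
      simp only [Finset.mem_filter] <;> rintro x ⟨hx, hfx⟩
    · exact ⟨hs x hx, fun h => hfx (by rw [hf x hx] at h; exact h.symm)⟩
    · exact hf x hx
    · exact hfx

/-! ### Blocks and the transfer of primitivity. -/

namespace Equiv.Perm

open MulAction Subgroup

variable {α : Type*}

/-- Points with the same stabilizer in `⟨g⟩` lie in the same cycle of `g`: the cycles of `g`
(fixed points included) have pairwise distinct lengths. -/
def HasDistinctCycles (g : Perm α) : Prop :=
  ∀ x y, (∀ k : ℤ, (g ^ k) x = x ↔ (g ^ k) y = y) → g.SameCycle x y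

theorem isBlock_iff_of_mem {K : Subgroup (Perm α)} {B : Set α} :
    IsBlock K B ↔ ∀ k ∈ K, ∀ x ∈ B, k x ∈ B → k • B = B := by
  rw [isBlock_iff_smul_eq_of_mem]
  exact ⟨fun h k hk x hx hkx => h (g := ⟨k, hk⟩) hx hkx,
    fun h k x hx hkx => h k k.2 x hx hkx⟩

/-- Otherwise every power of g taking one point of B into B fixes B pointwise. All points of B then
have the same stabilizer in ⟨g⟩, hence lie in one cycle; but a power of g carrying one to another
would have to fix it. -/
theorem HasDistinctCycles.exists_zpow_smul_eq {g : Perm α} (hg : g.HasDistinctCycles)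
    {K : Subgroup (Perm α)} (hgK : g ∈ K) {B : Set α} (hB : IsBlock K B) (hB2 : B.Nontrivial) :
    ∃ k : ℤ, (g ^ k) • B = B ∧ ∃ x ∈ B, (g ^ k) x ≠ x := by
  by_contra! H
  rw [isBlock_iff_of_mem] at hB
  obtain ⟨x, hx, y, hy, hxy⟩ := hB2
  have key : ∀ k : ℤ, ∀ z ∈ B, (g ^ k) z ∈ B → ∀ w ∈ B, (g ^ k) w = w :=
    fun k z hz hkz w hw => H k (hB _ (K.zpow_mem hgK k) z hz hkz) w hw
  obtain ⟨j, hj⟩ := hg x y fun k =>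
    ⟨fun h => key k x hx (h.symm ▸ hx) y hy, fun h => key k y hy (h.symm ▸ hy) x hx⟩
  exact hxy ((key j x hx (hj.symm ▸ hy) x hx).symm.trans hj)

/-- If the generators permute the K-translates of B, all translates under the generated group are
K-translates, so they are still equal or disjoint. -/
theorem isBlock_closure_of_smul_mem_orbit [Finite α] {K : Subgroup (Perm α)} {S : Set (Perm α)}
    {B : Set α} (hB : IsBlock K B) (hS : ∀ s ∈ S, ∀ k ∈ K, ∃ k' ∈ K, s • k • B = k' • B) :
    IsBlock (closure S) B := by
  have hle : closure S ≤ stabilizer (Perm α) (orbit K B) := by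
    rw [closure_le]
    intro s hs
    rw [SetLike.mem_coe, mem_stabilizer_set_iff_smul_set_subset (Set.toFinite _)]
    rintro _ ⟨_, ⟨k, rfl⟩, rfl⟩
    obtain ⟨k', hk', h⟩ := hS s hs k k.2
    exact ⟨⟨k', hk'⟩, h.symm⟩
  have hmem : ∀ l ∈ closure S, ∃ k : K, l • B = k • B := by
    intro l hl
    have h1 : l • orbit K B = orbit K B := hle hl
    have h2 : l • B ∈ orbit K B := by
      rw [← h1]
      exact Set.smul_mem_smul_set (mem_orbit_self B)
    obtain ⟨k, hk⟩ := h2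
    exact ⟨k, hk.symm⟩
  intro l₁ l₂ h
  obtain ⟨k₁, h₁⟩ := hmem l₁ l₁.2
  obtain ⟨k₂, h₂⟩ := hmem l₂ l₂.2
  have h₁' : l₁ • B = k₁ • B := h₁
  have h₂' : l₂ • B = k₂ • B := h₂
  rw [h₁', h₂'] at h ⊢
  exact hB h

theorem isPretransitive_of_forall_mem_orbit {K : Subgroup (Perm α)} {S : Set (Perm α)}
    [IsPretransitive (closure S) α] (hS : ∀ s ∈ S, ∀ x, s x ∈ orbit K x) :
    IsPretransitive K α := by
  have h : ∀ l ∈ closure S, ∀ x, l x ∈ orbit K x := by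
    intro l hl
    induction hl using closure_induction with
    | mem s hs => exact hS s hs
    | one => exact fun x => mem_orbit_self x
    | mul a b _ _ iha ihb =>
      intro x
      rw [← orbit_eq_iff.2 (ihb x)]
      exact iha (b x)
    | inv a _ iha =>
      intro x
      have := iha (a⁻¹ x)
      rw [show a (a⁻¹ x) = x by simp] at this
      exact (mem_orbit_symm).1 this
  constructor
  intro x y
  obtain ⟨l, hl⟩ := exists_smul_eq (closure S) x y
  have h3 := h l l.2 x
  rw [show (l : Perm α) x = y from hl] at h3
  exact h3

theorem SameCycle.mem_orbit {K : Subgroup (Perm α)} {g : Perm α} (hg : g ∈ K) {x y : α}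
    (h : g.SameCycle x y) : y ∈ orbit K x := by
  obtain ⟨k, hk⟩ := h
  exact ⟨⟨g ^ k, K.zpow_mem hg k⟩, hk⟩

/-- Since t moves points inside cycles of g, transitivity passes to ⟨g, x⟩. A nontrivial block whose
translates are permuted by t would also be a block for ⟨g, xt⟩. -/
theorem isPreprimitive_of_mul_right [Finite α] {g x t : Perm α}
    (hprim : IsPreprimitive (closure {g, x * t}) α) (ht : ∀ y, g.SameCycle y (t y))
    (hblock : ∀ B : Set α, IsBlock (closure {g, x}) B → B.Nontrivial → B ≠ _root_.Set.univ →
      ∃ B' : Set α, IsBlock (closure {g, x}) B' ∧ B'.Nontrivial ∧ B' ≠ _root_.Set.univ ∧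
        ∀ k ∈ closure {g, x}, ∃ k' ∈ closure {g, x}, t • k • B' = k' • B') :
    IsPreprimitive (closure {g, x}) α := by
  set K := closure {g, x} with hK
  have hgK : g ∈ K := subset_closure (by simp)
  have hxK : x ∈ K := subset_closure (by simp)
  have htr : IsPretransitive K α := by
    refine isPretransitive_of_forall_mem_orbit (S := {g, x * t}) ?_
    rintro s (rfl | rfl) y
    · exact ⟨⟨s, hgK⟩, rfl⟩
    · rw [← orbit_eq_iff.2 ((ht y).mem_orbit hgK)]
      exact ⟨⟨x, hxK⟩, rfl⟩
  refine ⟨fun {B} hB => ?_⟩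
  by_contra hcon
  rw [IsTrivialBlock, not_or, Set.not_subsingleton_iff] at hcon
  obtain ⟨B', hB', hnt, hne, hs⟩ := hblock B hB hcon.1 hcon.2
  have hb : IsBlock (closure {g, x * t}) B' := by
    refine isBlock_closure_of_smul_mem_orbit hB' ?_
    rintro s (rfl | rfl) k hk
    · exact ⟨s * k, K.mul_mem hgK hk, by rw [mul_smul]⟩
    · obtain ⟨k', hk', h⟩ := hs k hk
      exact ⟨x * k', K.mul_mem hxK hk', by rw [mul_smul, h, mul_smul]⟩
  rcases hprim.isTrivialBlock_of_isBlock hb with h | h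
  · exact Set.not_subsingleton_iff.2 hnt h
  · exact hne h

end Equiv.Perm

/-! ### Multipliers that preserve primitivity. -/

namespace Equiv.Perm

open MulAction Subgroup

variable {α : Type*}

theorem exists_minimal_block [Finite α] {K : Subgroup (Perm α)} {B : Set α} (hB : IsBlock K B)
    (hnt : B.Nontrivial) (hne : B ≠ _root_.Set.univ) :
    ∃ B' : Set α, IsBlock K B' ∧ B'.Nontrivial ∧ B' ≠ _root_.Set.univ ∧
      ∀ C, IsBlock K C → C.Nontrivial → C ⊆ B' → C = B' := by
  obtain ⟨B', ⟨h1, h2, h3⟩, hmin⟩ := Set.exists_min_image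
    {C : Set α | IsBlock K C ∧ C.Nontrivial ∧ C ≠ _root_.Set.univ} Set.ncard (Set.toFinite _)
    ⟨B, hB, hnt, hne⟩
  refine ⟨B', h1, h2, h3, fun C hC hCnt hCB => ?_⟩
  refine Set.eq_of_subset_of_ncard_le hCB (hmin C ⟨hC, hCnt, fun h => h3 ?_⟩) (Set.toFinite _)
  rw [h] at hCB
  exact Set.univ_subset_iff.1 hCB

theorem conj_mem_closure_pair {g x t : Perm α} {a : ℤ} (hg : t * g * t⁻¹ = g ^ a)
    (hx : t * x = x * t) : ∀ k ∈ closure {g, x}, t * k * t⁻¹ ∈ closure {g, x} := by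
  have : closure {g, x} ≤ (closure {g, x}).comap (MulAut.conj t).toMonoidHom := by
    rw [closure_le]
    rintro s (rfl | rfl)
    · change t * s * t⁻¹ ∈ closure {s, x}
      rw [hg]
      exact zpow_mem (subset_closure (by simp)) a
    · change t * s * t⁻¹ ∈ closure {g, s}
      rw [hx, mul_inv_cancel_right]
      exact subset_closure (by simp)
  exact fun k hk => this hk

/-- Take g^s stabilizing B and moving y ∈ B, and write t y = g^i y. As t normalizes ⟨g, x⟩, t g^i B
is a block; it contains y and g^s y, so by minimality it equals B. Thus t sends translates of B to
translates of B. -/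
theorem HasDistinctCycles.smul_block_mem_orbit [Finite α] {g x t : Perm α}
    (hd : g.HasDistinctCycles) {a : ℤ} (hg : t * g * t⁻¹ = g ^ a) (hx : t * x = x * t)
    (htt : t * t = 1) (ht : ∀ y, g.SameCycle y (t y)) {B : Set α}
    (hB : IsBlock (closure {g, x}) B) (hnt : B.Nontrivial)
    (hmin : ∀ C, IsBlock (closure {g, x}) C → C.Nontrivial → C ⊆ B → C = B) :
    ∀ k ∈ closure {g, x}, ∃ k' ∈ closure {g, x}, t • k • B = k' • B := by
  set K := closure {g, x} with hK
  have hgK : g ∈ K := subset_closure (by simp)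
  have hconj : ∀ k ∈ K, t * k * t⁻¹ ∈ K := conj_mem_closure_pair hg hx
  have htinv : t⁻¹ = t := inv_eq_of_mul_eq_one_left htt
  have htt' : ∀ y, t (t y) = y := fun y => by
    rw [← mul_apply, htt, one_apply]
  obtain ⟨s, hs, y, hy, hsy⟩ := hd.exists_zpow_smul_eq hgK hB hnt
  obtain ⟨i, hi⟩ := ht y
  have hC : IsBlock K (g ^ i • B) := hB.translate (⟨g ^ i, K.zpow_mem hgK i⟩ : K)
  have htC : IsBlock K (t • g ^ i • B) := by
    rw [isBlock_iff_of_mem] at hC ⊢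
    rintro k hk _ ⟨z, hz, rfl⟩ ⟨w, hw, hwz⟩
    have h2 : (t * k * t⁻¹) z = w := by
      rw [htinv, mul_apply, mul_apply]
      have : t w = k (t z) := hwz
      rw [← this, htt']
    have h3 := hC _ (hconj k hk) z hz (h2 ▸ hw)
    nth_rewrite 2 [← h3]
    rw [← mul_smul, ← mul_smul, ← mul_smul, ← mul_smul]
    congr 1
    rw [htinv]
    calc k * (t * g ^ i) = (t * t) * k * t * g ^ i := by rw [htt]; group
      _ = t * (t * k * t) * g ^ i := by group
      _ = t * (t * k * t * g ^ i) := by group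
  have hmem1 : y ∈ t • g ^ i • B :=
    ⟨t y, hi ▸ Set.smul_mem_smul_set (a := g ^ i) hy, htt' y⟩
  have hmem2 : (g ^ s) y ∈ B := hs ▸ Set.smul_mem_smul_set (a := g ^ s) hy
  have hmem3 : (g ^ s) y ∈ t • g ^ i • B := by
    refine ⟨t ((g ^ s) y), ?_, htt' _⟩
    -- Since t g^s = g^(sa) t, this point is g^i applied to g^(sa) y, and g^(sa) still stabilizes B.
    have h4 : t ((g ^ s) y) = (g ^ i) (((g ^ s) ^ a) y) := by
      have : t * g ^ s = (g ^ s) ^ a * t := by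
        have h5 : t * g ^ s * t⁻¹ = (t * g * t⁻¹) ^ s := (conj_zpow).symm
        rw [hg, ← zpow_mul, mul_comm, zpow_mul] at h5
        rw [← h5, inv_mul_cancel_right]
      have h6 := congrArg (fun f : Perm α => f y) this
      simp only [mul_apply] at h6
      rw [h6, ← hi, ← mul_apply, ← mul_apply]
      congr 1
      exact (((Commute.refl g).zpow_zpow s i).zpow_left a).eq
    rw [h4]
    refine Set.smul_mem_smul_set (a := g ^ i) ?_
    have h7 : ((g ^ s) ^ a) • B = B := by
      have : g ^ s ∈ stabilizer (Perm α) B := hs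
      exact (stabilizer (Perm α) B).zpow_mem this a
    nth_rewrite 1 [← h7]
    exact Set.smul_mem_smul_set hy
  have hinter := hmin (B ∩ t • g ^ i • B) (hB.inter htC)
    ⟨_, ⟨hy, hmem1⟩, _, ⟨hmem2, hmem3⟩, hsy.symm⟩ Set.inter_subset_left
  have hsub : B ⊆ t • g ^ i • B := Set.inter_eq_left.1 hinter
  have heq : B = t • g ^ i • B :=
    Set.eq_of_subset_of_ncard_le hsub (by rw [Set.ncard_smul_set, Set.ncard_smul_set])
      (Set.toFinite _)
  intro k hk
  refine ⟨t * k * t⁻¹ * g ^ i, K.mul_mem (hconj k hk) (K.zpow_mem hgK i), ?_⟩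
  nth_rewrite 1 [heq]
  rw [htinv]
  simp only [mul_smul]

/-- Multiplying `x` by an involution that normalizes `⟨g⟩`, fixes the cycles of `g` and commutes
with `x` does not affect primitivity of `⟨g, x⟩`. -/
theorem HasDistinctCycles.isPreprimitive_mul_right [Finite α] {g x t : Perm α}
    (hd : g.HasDistinctCycles) {a : ℤ} (hg : t * g * t⁻¹ = g ^ a) (hx : t * x = x * t)
    (htt : t * t = 1) (ht : ∀ y, g.SameCycle y (t y))
    (hprim : IsPreprimitive (closure {g, x}) α) : IsPreprimitive (closure {g, x * t}) α := by
  have hx' : t * (x * t) = x * t * t := by rw [← mul_assoc, hx]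
  -- The transfer lemma is applied to xt, since (xt)t = x.
  refine isPreprimitive_of_mul_right (t := t) (by rwa [mul_assoc, htt, mul_one]) ht ?_
  intro B hB hnt hne
  obtain ⟨B', h1, h2, h3, h4⟩ := exists_minimal_block hB hnt hne
  exact ⟨B', h1, h2, h3, hd.smul_block_mem_orbit hg hx' htt ht h1 h2 h4⟩

/-- If every nontrivial element of `⟨g⟩` has `z` as a power, then multiplying `x` by an involution
which fixes the cycles of `z` does not affect primitivity of `⟨g, x⟩`. -/
theorem HasDistinctCycles.isPreprimitive_mul_right_of_zpow [Finite α] {g x z h : Perm α}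
    (hd : g.HasDistinctCycles) (hzg : z ∈ zpowers g)
    (hz : ∀ k : ℤ, g ^ k ≠ 1 → z ∈ zpowers (g ^ k))
    (hh : ∀ y, z.SameCycle y (h y)) (hhh : h * h = 1)
    (hprim : IsPreprimitive (closure {g, x}) α) : IsPreprimitive (closure {g, x * h}) α := by
  refine isPreprimitive_of_mul_right (t := h) (by rwa [mul_assoc, hhh, mul_one]) ?_ ?_
  · intro y
    obtain ⟨k, hk⟩ := hh y
    obtain ⟨j, rfl⟩ := hzg
    exact ⟨j * k, by rw [zpow_mul]; exact hk⟩
  · intro B hB hnt hne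
    refine ⟨B, hB, hnt, hne, fun k hk => ⟨k, hk, ?_⟩⟩
    have hkB : IsBlock (closure {g, x * h}) (k • B) := hB.translate (⟨k, hk⟩ : closure {g, x * h})
    have hkn : (k • B).Nontrivial := by
      rw [← Set.image_smul]
      exact hnt.image (MulAction.injective k)
    obtain ⟨s, hs, y, hy, hsy⟩ := hd.exists_zpow_smul_eq (subset_closure (by simp)) hkB hkn
    have hzs : zpowers (g ^ s) ≤ stabilizer (Perm α) (k • B) := by
      rw [zpowers_le]
      exact hs
    have hzB := hzs (hz s fun h1 => hsy (by rw [h1]; rfl))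
    refine Set.eq_of_subset_of_ncard_le ?_ (Set.ncard_smul_set h _).ge (Set.toFinite _)
    rintro _ ⟨w, hw, rfl⟩
    obtain ⟨j, hj⟩ := hh w
    have hj' : (z ^ j) • (k • B) = k • B := (stabilizer (Perm α) (k • B)).zpow_mem hzB j
    rw [← hj']
    exact ⟨w, hw, hj⟩

end Equiv.Perm

/-! ### Involutions normalizing or centralizing a permutation. -/

namespace Equiv.Perm

variable {α : Type*}

/-- Choosing a base point `r` in every cycle of `g`, the maps `gᵏ r ↦ gᵃᵏ r`. -/
theorem exists_power_maps (g : Perm α) : ∃ θ : ℤ → α → α,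
    (∀ a y, g.SameCycle y (θ a y)) ∧ (∀ a b y, θ a (θ b y) = θ (a * b) y) ∧
    (∀ a k y, θ a ((g ^ k) y) = (g ^ (a * k)) (θ a y)) ∧
    (∀ a b, g ^ a = g ^ b → θ a = θ b) ∧ θ 1 = id := by
  let r : α → α := fun y => (Quotient.mk (SameCycle.setoid g) y).out
  have hr : ∀ y, g.SameCycle (r y) y := fun y => Quotient.mk_out (s := SameCycle.setoid g) y
  have hrr : ∀ y z, g.SameCycle y z → r y = r z := fun y z h =>
    congrArg Quotient.out (Quotient.sound (s := SameCycle.setoid g) h)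
  choose k hk using hr
  -- This makes gᵏ r ↦ gᵃᵏ r independent of the exponent k chosen for a point.
  have key : ∀ (a u v : ℤ) w, (g ^ u) w = (g ^ v) w → (g ^ (a * u)) w = (g ^ (a * v)) w := by
    intro a u v w h
    have h1 : (g ^ (u - v)) w = w := by
      rw [sub_eq_neg_add, zpow_add, mul_apply, h, ← mul_apply, ← zpow_add, neg_add_cancel,
        zpow_zero, one_apply]
    have h2 : ((g ^ (u - v)) ^ a) w = w := zpow_apply_eq_self_of_apply_eq_self h1 a
    rw [show a * u = a * v + (u - v) * a by ring, zpow_add, mul_apply, zpow_mul g (u - v), h2]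
  have spec : ∀ (a u : ℤ) y z, (g ^ u) (r y) = z →
      (g ^ (a * k z)) (r z) = (g ^ (a * u)) (r y) := by
    intro a u y z h
    have h1 : r z = r y := (hrr y z ((show g.SameCycle y (r y) from
      SameCycle.symm ⟨k y, hk y⟩).trans ⟨u, h⟩)).symm
    rw [h1]
    refine key a _ _ _ ?_
    rw [h, ← h1]
    exact hk z
  refine ⟨fun a y => (g ^ (a * k y)) (r y), ?_, ?_, ?_, ?_, ?_⟩
  · exact fun a y => (SameCycle.symm ⟨k y, hk y⟩).trans ⟨a * k y, rfl⟩
  · intro a b y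
    beta_reduce
    rw [spec a (b * k y) y _ rfl, mul_assoc]
  · intro a j y
    beta_reduce
    rw [spec a (j + k y) y _ (by rw [zpow_add, mul_apply, hk]), mul_add, zpow_add, mul_apply]
  · intro a b h
    funext y
    beta_reduce
    rw [zpow_mul, h, zpow_mul]
  · funext y
    simp [hk]

/-- If the order of `g` is odd and divisible by two primes, then `⟨g⟩` is normalized by an even
involution fixing the cycles of `g`. -/
theorem exists_even_normalizing_involution [Fintype α] [DecidableEq α] {g : Perm α} {u v : ℕ}
    (hu : u ≠ 1) (hv : v ≠ 1) (huv : u.Coprime v) (hord : orderOf g = u * v)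
    (hodd : Odd (orderOf g)) :
    ∃ (t : Perm α) (a : ℤ), t * g * t⁻¹ = g ^ a ∧ t * t = 1 ∧ t ≠ 1 ∧ sign t = 1 ∧
      ∀ y, g.SameCycle y (t y) := by
  obtain ⟨θ, hcyc, hmul, hzpow, hcongr, hone⟩ := exists_power_maps g
  have hodd' : Odd u ∧ Odd v := Nat.odd_mul.1 (hord ▸ hodd)
  have hinv : ∀ a : ℤ, g ^ (a * a) = g ^ (1 : ℤ) → Function.Involutive (θ a) := by
    intro a ha y
    rw [hmul, hcongr _ _ ha, hone, id]
  have heq : ∀ a b : ℤ, g ^ a = g ^ b ↔ ((u * v : ℕ) : ℤ) ∣ a - b := by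
    intro a b
    rw [← hord, orderOf_dvd_iff_zpow_eq_one, zpow_sub, mul_inv_eq_one]
  have main : ∀ (a : ℤ) (ha : g ^ (a * a) = g ^ (1 : ℤ)), g ^ a ≠ g ^ (1 : ℤ) →
      sign (hinv a ha).toPerm = 1 →
      ∃ (t : Perm α) (a : ℤ), t * g * t⁻¹ = g ^ a ∧ t * t = 1 ∧ t ≠ 1 ∧ sign t = 1 ∧
        ∀ y, g.SameCycle y (t y) := by
    intro a ha hne hs
    have h1 : (hinv a ha).toPerm * g = g ^ a * (hinv a ha).toPerm := by
      ext y
      have := hzpow a 1 y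
      simpa using this
    refine ⟨(hinv a ha).toPerm, a, ?_, ?_, ?_, hs, hcyc a⟩
    · rw [h1, mul_inv_cancel_right]
    · ext y
      exact hinv a ha y
    · intro h
      rw [h, one_mul, mul_one] at h1
      exact hne (by rw [← h1, zpow_one])
  have hcop : IsCoprime (u : ℤ) v := Nat.isCoprime_iff_coprime.2 huv
  obtain ⟨c, d, hcd⟩ := id hcop
  have key : ∀ w : ℕ, w ≠ 1 → Odd w → ¬ (w : ℤ) ∣ 2 := by
    intro w hw1 hw2 h
    have h2 : w ∣ 2 := by exact_mod_cast h
    rcases (Nat.dvd_prime Nat.prime_two).1 h2 with h3 | h3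
    · exact hw1 h3
    · rw [h3] at hw2
      exact absurd hw2 (by decide)
  -- By cu + dv = 1, a is -1 modulo u and 1 modulo v: a square root of 1 modulo uv other than ±1.
  set a : ℤ := c * u - d * v with hadef
  have ha1 : g ^ (a * a) = g ^ (1 : ℤ) := by
    rw [heq]
    refine ⟨-4 * c * d, ?_⟩
    have : (1 : ℤ) = (c * u + d * v) * (c * u + d * v) := by rw [hcd]; norm_num
    rw [this]
    push_cast
    ring
  have ha2 : g ^ (-a * -a) = g ^ (1 : ℤ) := by rw [neg_mul_neg, ha1]
  have ha3 : g ^ ((-1 : ℤ) * -1) = g ^ (1 : ℤ) := by norm_num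
  have hn1 : g ^ a ≠ g ^ (1 : ℤ) := by
    rw [Ne, heq]
    intro h
    refine key u hu hodd'.1 ?_
    have h1 : (u : ℤ) ∣ a - 1 := (Dvd.intro _ (by push_cast; rfl)).trans h
    have h2 : (2 : ℤ) = 2 * c * u - (a - 1) := by rw [hadef]; linear_combination -hcd
    rw [h2]
    exact dvd_sub (Dvd.intro_left _ rfl) h1
  have hn2 : g ^ (-a) ≠ g ^ (1 : ℤ) := by
    rw [Ne, heq]
    intro h
    refine key v hv hodd'.2 ?_
    have h1 : (v : ℤ) ∣ -a - 1 := (Dvd.intro_left _ (by push_cast; rfl)).trans h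
    have h2 : (2 : ℤ) = 2 * d * v - (-a - 1) := by rw [hadef]; linear_combination -hcd
    rw [h2]
    exact dvd_sub (Dvd.intro_left _ rfl) h1
  have hn3 : g ^ (-1 : ℤ) ≠ g ^ (1 : ℤ) := by
    rw [Ne, heq]
    intro h
    refine key u hu hodd'.1 ?_
    have h1 : (u : ℤ) ∣ -1 - 1 := (Dvd.intro _ (by push_cast; rfl)).trans h
    norm_num at h1
    exact h1
  by_cases hs1 : sign (hinv a ha1).toPerm = 1
  · exact main a ha1 hn1 hs1
  by_cases hs2 : sign (hinv (-a) ha2).toPerm = 1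
  · exact main (-a) ha2 hn2 hs2
  -- The maps for a and -a multiply to the one for -1, so if both are odd, that one is even.
  refine main (-1) ha3 hn3 ?_
  have hprod : (hinv (-1) ha3).toPerm = (hinv a ha1).toPerm * (hinv (-a) ha2).toPerm := by
    ext y
    have h2 : g ^ (a * -a) = g ^ (-1 : ℤ) := by
      rw [mul_neg, zpow_neg, ha1, zpow_neg]
    change θ (-1) y = θ a (θ (-a) y)
    rw [hmul, hcongr _ _ h2]
  rw [hprod, map_mul, (Int.units_eq_one_or _).resolve_left hs1,
    (Int.units_eq_one_or _).resolve_left hs2]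
  decide

open Classical in
/-- A permutation with two cycles of the same length commutes with the involution swapping them. -/
theorem exists_commuting_involution_of_not_hasDistinctCycles {g : Perm α}
    (hg : ¬ g.HasDistinctCycles) : ∃ c : Perm α, c * c = 1 ∧ c ≠ 1 ∧ c * g = g * c := by
  simp only [HasDistinctCycles, not_forall] at hg
  obtain ⟨x, y, hxy, hnc⟩ := hg
  have key : ∀ i j : ℤ, (g ^ i) x = (g ^ j) x ↔ (g ^ i) y = (g ^ j) y := by
    intro i j
    have : ∀ z, (g ^ i) z = (g ^ j) z ↔ (g ^ (i - j)) z = z := by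
      intro z
      rw [sub_eq_neg_add, zpow_add, mul_apply, zpow_neg, inv_eq_iff_eq, eq_comm, eq_comm]
    rw [this, this, hxy]
  let f : α → α := fun z =>
    if h : g.SameCycle x z then (g ^ h.choose) y
    else if h : g.SameCycle y z then (g ^ h.choose) x else z
  have hfx : ∀ i : ℤ, f ((g ^ i) x) = (g ^ i) y := by
    intro i
    have h : g.SameCycle x ((g ^ i) x) := ⟨i, rfl⟩
    simp only [f, dif_pos h]
    exact (key _ _).1 h.choose_spec
  have hfy : ∀ i : ℤ, f ((g ^ i) y) = (g ^ i) x := by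
    intro i
    have h : g.SameCycle y ((g ^ i) y) := ⟨i, rfl⟩
    have h' : ¬ g.SameCycle x ((g ^ i) y) := fun h' => hnc (h'.trans h.symm)
    simp only [f, dif_neg h', dif_pos h]
    exact (key _ _).2 h.choose_spec
  have hfz : ∀ z, ¬ g.SameCycle x z → ¬ g.SameCycle y z → f z = z := by
    intro z h1 h2
    simp only [f, dif_neg h1, dif_neg h2]
  have hf : Function.Involutive f := by
    intro z
    by_cases h1 : g.SameCycle x z
    · obtain ⟨i, rfl⟩ := h1
      rw [hfx, hfy]
    by_cases h2 : g.SameCycle y z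
    · obtain ⟨i, rfl⟩ := h2
      rw [hfy, hfx]
    rw [hfz z h1 h2, hfz z h1 h2]
  refine ⟨hf.toPerm, ?_, ?_, ?_⟩
  · ext z
    exact hf z
  · intro h
    have h1 := congrArg (fun p : Perm α => p x) h
    have h2 := hfx 0
    simp only [zpow_zero, one_apply] at h2
    have h3 : f x = x := h1
    exact hnc (by rw [← h2, h3])
  · ext z
    change f (g z) = g (f z)
    by_cases h1 : g.SameCycle x z
    · obtain ⟨i, rfl⟩ := h1
      rw [hfx, ← mul_apply, ← mul_apply, ← zpow_one_add, hfx]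
    by_cases h2 : g.SameCycle y z
    · obtain ⟨i, rfl⟩ := h2
      rw [hfy, ← mul_apply, ← mul_apply, ← zpow_one_add, hfy]
    rw [hfz z h1 h2, hfz]
    · rwa [sameCycle_apply_right]
    · rwa [sameCycle_apply_right]

end Equiv.Perm

/-! ### The prime power case, and the centralizer of the alternating group. -/

namespace Equiv.Perm

open MulAction Subgroup

variable {α : Type*}

/-- The subgroups of a cyclic p-group form a chain, and g^(p^k) generates the smallest nontrivial
one. -/
theorem exists_zpow_of_orderOf_eq_prime_pow {G : Type*} [Group G] {g : G} {p k : ℕ} (hp : p.Prime)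
    (hord : orderOf g = p ^ (k + 1)) (j : ℤ) (hj : g ^ j ≠ 1) : g ^ p ^ k ∈ zpowers (g ^ j) := by
  have h1 : Int.gcd j (p ^ (k + 1) : ℕ) ∣ p ^ (k + 1) :=
    Int.natCast_dvd_natCast.1 (Int.gcd_dvd_right ..)
  obtain ⟨e, he, hge⟩ := (Nat.dvd_prime_pow hp).1 h1
  have he' : e ≤ k := by
    by_contra! h
    have h2 : e = k + 1 := le_antisymm he h
    refine hj ?_
    rw [← orderOf_dvd_iff_zpow_eq_one, hord, ← h2, ← hge]
    exact Int.gcd_dvd_left ..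
  have h3 : g ^ p ^ e ∈ zpowers (g ^ j) := by
    refine ⟨Int.gcdA j (p ^ (k + 1) : ℕ), ?_⟩
    have h4 := Int.gcd_eq_gcd_ab j (p ^ (k + 1) : ℕ)
    rw [hge] at h4
    change (g ^ j) ^ _ = _
    rw [← zpow_natCast g (p ^ e), h4, zpow_add, ← zpow_mul, zpow_mul g ((p ^ (k + 1) : ℕ) : ℤ),
      zpow_natCast, ← hord, pow_orderOf_eq_one, one_zpow, mul_one]
  have h5 : g ^ p ^ k = (g ^ p ^ e) ^ p ^ (k - e) := by
    rw [← pow_mul, ← pow_add, Nat.add_sub_cancel' he']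
  rw [h5]
  exact pow_mem h3 _

theorem sameCycle_swap_apply [DecidableEq α] {z : Perm α} {a b : α} (h : z.SameCycle a b) (y : α) :
    z.SameCycle y (swap a b y) := by
  rw [swap_apply_def]
  split_ifs with h1 h2
  · exact h1 ▸ h
  · exact h2 ▸ h.symm
  · exact SameCycle.refl _ _

/-- All cycles have length 1 or 3, so there is at most one of each. This excludes order 3 when there
are more than four points. -/
theorem HasDistinctCycles.card_le_four [Fintype α] {g : Perm α} (hd : g.HasDistinctCycles)
    (hord : orderOf g = 3) : Fintype.card α ≤ 4 := by
  classical
  have hg3 : g ^ 3 = 1 := hord ▸ pow_orderOf_eq_one g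
  have hg1 : g ≠ 1 := by
    rintro rfl
    simp at hord
  obtain ⟨x, hx⟩ : ∃ x, g x ≠ x := by
    by_contra! h
    exact hg1 (Equiv.ext h)
  have hmoved : ∀ y, g y ≠ y → ∀ k : ℤ, (g ^ k) y = y ↔ (3 : ℤ) ∣ k := by
    intro y hy k
    constructor
    · intro h
      by_contra hk
      obtain ⟨j, hj⟩ := exists_zpow_of_orderOf_eq_prime_pow (k := 0) Nat.prime_three
        (by simpa using hord) k (by rwa [Ne, ← orderOf_dvd_iff_zpow_eq_one, hord])
      have h1 : ((g ^ k) ^ j) y = y := zpow_apply_eq_self_of_apply_eq_self h j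
      have h2 : (g ^ k) ^ j = g := by simpa using hj
      exact hy (by rwa [h2] at h1)
    · rintro ⟨j, rfl⟩
      rw [zpow_mul, show g ^ (3 : ℤ) = 1 from mod_cast hg3, one_zpow, one_apply]
  have hfix : (Finset.univ.filter fun y => g y = y).card ≤ 1 := by
    rw [Finset.card_le_one]
    intro y hy w hw
    simp only [Finset.mem_filter, Finset.mem_univ, true_and] at hy hw
    obtain ⟨i, hi⟩ := hd y w fun k => by
      simp [zpow_apply_eq_self_of_apply_eq_self hy k, zpow_apply_eq_self_of_apply_eq_self hw k]
    rw [← hi, zpow_apply_eq_self_of_apply_eq_self hy i]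
  have hmov : (Finset.univ.filter fun y => ¬ g y = y) ⊆ {x, g x, g (g x)} := by
    intro y hy
    simp only [Finset.mem_filter, Finset.mem_univ, true_and] at hy
    obtain ⟨i, hi⟩ := hd x y fun k => by rw [hmoved x hx, hmoved y hy]
    have h3 : (g ^ (i % 3)) x = y := by
      have h4 : i = i % 3 + 3 * (i / 3) := by omega
      rw [h4, zpow_add, mul_apply, (hmoved x hx _).2 (Dvd.intro _ rfl)] at hi
      exact hi
    have h5 : i % 3 = 0 ∨ i % 3 = 1 ∨ i % 3 = 2 := by omega
    rcases h5 with h5 | h5 | h5 <;> rw [h5] at h3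
    · simp [← h3]
    · simp [← h3]
    · rw [← h3]
      simp [zpow_ofNat, pow_two]
  have h6 := Finset.card_filter_add_card_filter_not (s := (Finset.univ : Finset α))
    (fun y => g y = y)
  have h7 := (Finset.card_le_card hmov).trans Finset.card_le_three
  rw [Finset.card_univ] at h6
  omega

/-- A point x moved by z lies in a g-cycle of full length, at least 5. This leaves room for y in
that cycle such that (x zx)(y zy) is a product of disjoint transpositions. -/
theorem HasDistinctCycles.exists_even_involution [Fintype α] [DecidableEq α] {g : Perm α}
    (hd : g.HasDistinctCycles) (hα : 4 < Fintype.card α) {p k : ℕ} (hp : p.Prime)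
    (hord : orderOf g = p ^ (k + 1)) (hodd : Odd (orderOf g)) :
    ∃ h : Perm α, h * h = 1 ∧ h ≠ 1 ∧ sign h = 1 ∧ ∀ y, (g ^ p ^ k).SameCycle y (h y) := by
  set z := g ^ p ^ k with hz
  have hz1 : z ≠ 1 := by
    intro h
    have := orderOf_dvd_of_pow_eq_one h
    rw [hord] at this
    have := (Nat.pow_dvd_pow_iff_le_right hp.one_lt).1 this
    omega
  obtain ⟨x, hx⟩ : ∃ x, z x ≠ x := by
    by_contra! h
    exact hz1 (Equiv.ext h)
  have hfree : ∀ i : ℤ, (g ^ i) x = x → g ^ i = 1 := by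
    intro i hi
    by_contra h
    obtain ⟨j, hj⟩ := exists_zpow_of_orderOf_eq_prime_pow hp hord i h
    have hj' : (g ^ i) ^ j = z := hj
    exact hx (by rw [← hj', zpow_apply_eq_self_of_apply_eq_self hi])
  have hN : 5 ≤ orderOf g := by
    have h1 : orderOf g ≠ 1 := by
      rw [hord]
      exact (Nat.one_lt_pow (by omega) hp.one_lt).ne'
    have h3 : orderOf g ≠ 3 := fun h => by
      have := hd.card_le_four h
      omega
    obtain ⟨m, hm⟩ := hodd
    omega
  have hinj : Set.InjOn (fun i : ℕ => (g ^ i) x) (Finset.range 5) := by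
    intro i hi j hj hij
    have h1 : g ^ ((i : ℤ) - j) = 1 := by
      apply hfree
      have hij' : (g ^ i) x = (g ^ j) x := hij
      rw [sub_eq_neg_add, zpow_add, mul_apply, zpow_natCast, hij', zpow_neg, zpow_natCast,
        ← mul_apply, inv_mul_cancel, one_apply]
    rw [← orderOf_dvd_iff_zpow_eq_one] at h1
    have hi' : i < 5 := by simpa using hi
    have hj' : j < 5 := by simpa using hj
    have := Int.eq_zero_of_abs_lt_dvd h1 (by rw [abs_lt]; constructor <;> omega)
    omega
  -- Excluding z⁻¹ x ensures z y ≠ x.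
  obtain ⟨y, hy, hyn⟩ : ∃ y ∈ (Finset.range 5).image (fun i : ℕ => (g ^ i) x),
      y ∉ ({x, z x, z⁻¹ x} : Finset α) := by
    apply Finset.exists_mem_notMem_of_card_lt_card
    rw [Finset.card_image_of_injOn hinj, Finset.card_range]
    exact Finset.card_le_three.trans_lt (by norm_num)
  obtain ⟨i, -, hi⟩ := Finset.mem_image.1 hy
  simp only [Finset.mem_insert, Finset.mem_singleton, not_or] at hyn
  obtain ⟨hy1, hy2, hy3⟩ := hyn
  have hzy : z y ≠ y := by
    rw [← hi]
    intro h
    apply hx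
    apply (g ^ i).injective
    rw [← mul_apply, ← h, ← mul_apply, hz, ← pow_add, ← pow_add, add_comm]
  have hxzy : x ≠ z y := by
    intro h
    exact hy3 (by rw [h, ← mul_apply, inv_mul_cancel, one_apply])
  have hzz : z x ≠ z y := fun h => hy1 (z.injective h).symm
  refine ⟨swap x (z x) * swap y (z y), ?_, ?_, ?_, ?_⟩
  · have hdis : swap x (z x) * swap y (z y) = swap y (z y) * swap x (z x) := by
      refine Disjoint.commute ?_
      rw [disjoint_iff_disjoint_support, support_swap hx.symm, support_swap hzy.symm]
      simp only [Finset.disjoint_insert_left, Finset.disjoint_singleton_left, Finset.mem_insert,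
        Finset.mem_singleton, not_or]
      exact ⟨⟨Ne.symm hy1, hxzy⟩, Ne.symm hy2, hzz⟩
    nth_rewrite 1 [hdis]
    rw [mul_assoc, ← mul_assoc (swap x _), swap_mul_self, one_mul, swap_mul_self]
  · intro h
    have h1 := congrArg (fun f : Perm α => f x) h
    simp only [mul_apply, one_apply] at h1
    rw [swap_apply_of_ne_of_ne (Ne.symm hy1) hxzy, swap_apply_left] at h1
    exact hx h1
  · rw [map_mul, sign_swap hx.symm, sign_swap hzy.symm]
    decide
  · intro w
    exact (sameCycle_swap_apply ⟨1, by rw [zpow_one]⟩ w).trans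
      (sameCycle_swap_apply ⟨1, by rw [zpow_one]⟩ _)

/-- If c x ≠ x, some 3-cycle fixes x and moves c x, so it does not commute with c. -/
theorem eq_one_of_forall_commute_alternatingGroup [Fintype α] [DecidableEq α]
    (hα : 3 < Fintype.card α) {c : Perm α} (hc : ∀ a ∈ alternatingGroup α, c * a = a * c) :
    c = 1 := by
  ext x
  by_contra h
  rw [one_apply] at h
  obtain ⟨d, -, hd⟩ := Finset.exists_mem_notMem_of_card_lt_card
    (s := ({x, c x} : Finset α)) (t := Finset.univ)
    (Finset.card_le_two.trans_lt (by rw [Finset.card_univ]; omega))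
  obtain ⟨e, -, he⟩ := Finset.exists_mem_notMem_of_card_lt_card
    (s := ({x, c x, d} : Finset α)) (t := Finset.univ)
    (Finset.card_le_three.trans_lt (by rw [Finset.card_univ]; omega))
  simp only [Finset.mem_insert, Finset.mem_singleton, not_or] at hd he
  have hmem : swap (c x) d * swap (c x) e ∈ alternatingGroup α := by
    rw [mem_alternatingGroup, map_mul, sign_swap (Ne.symm hd.2), sign_swap (Ne.symm he.2.1)]
    decide
  have h1 := congrArg (fun f : Perm α => f x) (hc _ hmem)
  simp only [mul_apply] at h1
  rw [swap_apply_of_ne_of_ne (Ne.symm h) (Ne.symm he.1),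
    swap_apply_of_ne_of_ne (Ne.symm h) (Ne.symm hd.1), swap_apply_left,
    swap_apply_of_ne_of_ne he.2.1 he.2.2] at h1
  exact he.2.1 h1.symm

end Equiv.Perm

/-! ### Counting the elements that generate G together with g. -/

namespace Equiv.Perm

open MulAction Subgroup

theorem closure_pair_conj {G : Type*} [Group G] {H : Subgroup G} [hH : H.Normal] {g x t : G} {a : ℤ}
    (hg : t * g * t⁻¹ = g ^ a) (hx : closure {g, x} = H) : closure {g, t * x * t⁻¹} = H := by
  have hgH : g ∈ H := hx ▸ subset_closure (by simp)
  have hxH : x ∈ H := hx ▸ subset_closure (by simp)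
  refine le_antisymm ?_ ?_
  · rw [closure_le]
    rintro s (rfl | rfl)
    · exact hgH
    · exact hH.conj_mem x hxH t
  · have h1 : closure {g, x} ≤ (closure {g, t * x * t⁻¹}).comap (MulAut.conj t).toMonoidHom := by
      rw [closure_le]
      rintro s (rfl | rfl)
      · change t * s * t⁻¹ ∈ closure {s, t * x * t⁻¹}
        rw [hg]
        exact zpow_mem (subset_closure (by simp)) a
      · change t * s * t⁻¹ ∈ closure {g, t * s * t⁻¹}
        exact subset_closure (by simp)
    intro y hy
    have h2 : t⁻¹ * y * t ∈ H := by simpa using hH.conj_mem y hy t⁻¹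
    rw [← hx] at h2
    have h3 : t * (t⁻¹ * y * t) * t⁻¹ ∈ closure {g, t * x * t⁻¹} := h1 h2
    have h4 : t * (t⁻¹ * y * t) * t⁻¹ = y := by group
    rwa [h4] at h3

variable {α : Type*} [Fintype α] [DecidableEq α]

theorem exists_commuting_involution_of_even_orderOf {G : Type*} [Group G] [Finite G] {g : G}
    (hg : Even (orderOf g)) : ∃ c : G, c * c = 1 ∧ c ≠ 1 ∧ c * g = g * c := by
  obtain ⟨m, hm⟩ := hg
  have hpos : 0 < orderOf g := orderOf_pos g
  refine ⟨g ^ m, ?_, ?_, ?_⟩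
  · rw [← pow_add, ← hm, pow_orderOf_eq_one]
  · intro h
    have := Nat.le_of_dvd (by omega) (orderOf_dvd_of_pow_eq_one h)
    omega
  · rw [← pow_succ, ← pow_succ']

open Classical in
theorem even_card_closure_pair_eq_of_commute {G : Subgroup (Perm α)} [G.Normal]
    (hα : 3 < Fintype.card α) (hG : alternatingGroup α ≤ G) {g c : Perm α} (hcc : c * c = 1)
    (hc1 : c ≠ 1) (hcg : c * g = g * c) :
    Even (Finset.univ.filter fun x : Perm α => closure {g, x} = G).card := by
  have hinv : c⁻¹ = c := inv_eq_of_mul_eq_one_left hcc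
  refine Finset.even_card_of_fixedPointFree_involution _ (fun x => c * x * c⁻¹) ?_ ?_ ?_ <;>
    simp only [Finset.mem_filter, Finset.mem_univ, true_and] <;> intro x hx
  · refine closure_pair_conj (a := 1) ?_ hx
    rw [hcg, mul_inv_cancel_right, zpow_one]
  · rw [hinv]
    calc c * (c * x * c) * c = (c * c) * x * (c * c) := by group
      _ = x := by rw [hcc, one_mul, mul_one]
  · intro h
    have hcx : c * x = x * c := by
      nth_rewrite 2 [← h]
      rw [inv_mul_cancel_right]
    refine hc1 (eq_one_of_forall_commute_alternatingGroup hα fun a ha => ?_)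
    have h1 : G ≤ centralizer {c} := by
      rw [← hx, closure_le]
      rintro s (rfl | rfl)
      · exact mem_centralizer_singleton_iff.2 hcg.symm
      · exact mem_centralizer_singleton_iff.2 hcx.symm
    exact (mem_centralizer_singleton_iff.1 (h1 (hG ha))).symm

open Classical in
/-- The number of `x` with `⟨g, x⟩ = G` is even, provided that for `g` of odd order this equality
only depends on the sign of `x` and on the primitivity of `⟨g, x⟩`. -/
theorem even_card_closure_pair_eq {G : Subgroup (Perm α)} [G.Normal]
    (hα : 4 < Fintype.card α) (hG : alternatingGroup α ≤ G) {g : Perm α} (hg1 : g ≠ 1) {ε : ℤˣ}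
    (hchar : Odd (orderOf g) → ∀ x, closure {g, x} = G ↔
      sign x = ε ∧ IsPreprimitive (closure {g, x}) α) :
    Even (Finset.univ.filter fun x : Perm α => closure {g, x} = G).card := by
  by_cases hc : ∃ c : Perm α, c * c = 1 ∧ c ≠ 1 ∧ c * g = g * c
  · obtain ⟨c, h1, h2, h3⟩ := hc
    exact even_card_closure_pair_eq_of_commute (by omega) hG h1 h2 h3
  have hodd : Odd (orderOf g) := by
    rw [← Nat.not_even_iff_odd]
    exact fun h => hc (exists_commuting_involution_of_even_orderOf h)
  have hd : g.HasDistinctCycles := by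
    by_contra h
    exact hc (exists_commuting_involution_of_not_hasDistinctCycles h)
  specialize hchar hodd
  have hN : orderOf g ≠ 1 := by rwa [Ne, orderOf_eq_one_iff]
  have hN0 : orderOf g ≠ 0 := (orderOf_pos g).ne'
  set p := (orderOf g).minFac with hpdef
  have hp : p.Prime := Nat.minFac_prime hN
  have hpos : 0 < (orderOf g).factorization p :=
    hp.factorization_pos_of_dvd hN0 (Nat.minFac_dvd _)
  -- The part of the order prime to p is trivial exactly when the order is a power of p.
  by_cases hpp : ordCompl[p] (orderOf g) = 1
  · obtain ⟨k, hk⟩ : ∃ k, (orderOf g).factorization p = k + 1 := ⟨_, (Nat.succ_pred hpos.ne').symm⟩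
    have hord : orderOf g = p ^ (k + 1) := by
      have := Nat.ordProj_mul_ordCompl_eq_self (orderOf g) p
      rw [hpp, mul_one, hk] at this
      exact this.symm
    obtain ⟨h, hhh, hh1, hsign, hcyc⟩ := hd.exists_even_involution hα hp hord hodd
    refine Finset.even_card_of_fixedPointFree_involution _ (fun x => x * h) ?_ ?_ ?_ <;>
      simp only [Finset.mem_filter, Finset.mem_univ, true_and] <;> intro x hx
    · rw [hchar] at hx ⊢
      refine ⟨by rw [map_mul, hsign, mul_one, hx.1], ?_⟩
      exact hd.isPreprimitive_mul_right_of_zpow (pow_mem (mem_zpowers g) _)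
        (exists_zpow_of_orderOf_eq_prime_pow hp hord) hcyc hhh hx.2
    · rw [mul_assoc, hhh, mul_one]
    · exact fun h' => hh1 (mul_eq_left.1 h')
  · have hpu : ordProj[p] (orderOf g) ≠ 1 := (Nat.one_lt_pow hpos.ne' hp.one_lt).ne'
    have hcop : (ordProj[p] (orderOf g)).Coprime (ordCompl[p] (orderOf g)) :=
      (Nat.coprime_ordCompl hp hN0).pow_left _
    obtain ⟨t, a, hta, htt, ht1, hsign, hcyc⟩ := exists_even_normalizing_involution hpu hpp hcop
      (Nat.ordProj_mul_ordCompl_eq_self (orderOf g) p).symm hodd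
    have hinv : t⁻¹ = t := inv_eq_of_mul_eq_one_left htt
    have hcomm : ∀ x, t * x * t⁻¹ = x → t * x = x * t := fun x hx => by
      nth_rewrite 2 [← hx]
      rw [inv_mul_cancel_right]
    refine Finset.even_card_of_two_involutions _ (fun x => t * x * t⁻¹) (fun x => x * t)
        ?_ ?_ ?_ ?_ ?_ <;>
      simp only [Finset.mem_filter, Finset.mem_univ, true_and] <;> intro x hx
    · exact closure_pair_conj hta hx
    · rw [hinv]
      calc t * (t * x * t) * t = (t * t) * x * (t * t) := by group
        _ = x := by rw [htt, one_mul, mul_one]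
    · intro hfix
      refine ⟨?_, ?_⟩
      · rw [hchar] at hx ⊢
        refine ⟨by rw [map_mul, hsign, mul_one, hx.1], ?_⟩
        exact hd.isPreprimitive_mul_right hta (hcomm x hfix) htt hcyc hx.2
      · rw [← mul_assoc, hcomm x hfix, mul_inv_cancel_right]
    · intro _
      rw [mul_assoc, htt, mul_one]
    · exact fun _ h' => ht1 (mul_eq_left.1 h')

theorem closure_singleton_ne_of_alternatingGroup_le {G : Subgroup (Perm α)}
    (hα : 3 < Fintype.card α) (hG : alternatingGroup α ≤ G) {g : Perm α} (hg : g ≠ 1) :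
    closure {g} ≠ G := by
  intro h
  refine hg (eq_one_of_forall_commute_alternatingGroup hα fun a ha => ?_)
  have h1 := hG ha
  rw [← h, mem_closure_singleton] at h1
  obtain ⟨k, rfl⟩ := h1
  exact ((Commute.refl _).zpow_right k).eq

theorem generatingGraph_adj_iff {G : Subgroup (Perm α)}
    (hα : 3 < Fintype.card α) (hG : alternatingGroup α ≤ G) {x y : {x : G // x ≠ 1}} :
    (generatingGraph G).Adj x y ↔ closure {((x : G) : Perm α), ((y : G) : Perm α)} = G := by
  have h1 : (closure {(x : G), (y : G)}).map G.subtype =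
      closure {((x : G) : Perm α), ((y : G) : Perm α)} := by
    rw [MonoidHom.map_closure]
    congr 1
    simp [Set.image_pair]
  have h2 : closure {(x : G), (y : G)} = ⊤ ↔
      closure {((x : G) : Perm α), ((y : G) : Perm α)} = G := by
    rw [← h1]
    constructor
    · intro h
      rw [h, ← MonoidHom.range_eq_map, range_subtype]
    · intro h
      apply map_injective G.subtype_injective
      rw [h, ← MonoidHom.range_eq_map, range_subtype]
  refine ⟨fun h => h2.1 h.2, fun h => ⟨?_, h2.2 h⟩⟩
  rintro rfl
  rw [Set.pair_eq_singleton] at h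
  exact closure_singleton_ne_of_alternatingGroup_le hα hG (fun h' => x.2 (Subtype.ext h')) h

/-- The conditions x ∈ G, x ≠ 1 and x ≠ g follow from ⟨g, x⟩ = G, because G is not cyclic. -/
theorem generatingDegree_eq_card {G : Subgroup (Perm α)} (hα : 3 < Fintype.card α)
    (hG : alternatingGroup α ≤ G) (g : {x : G // x ≠ 1}) :
    generatingDegree g = Nat.card {x : Perm α // closure {((g : G) : Perm α), x} = G} := by
  unfold generatingDegree
  rw [← @SimpleGraph.card_neighborSet_eq_degree _ _ _ (Fintype.ofFinite _),
    ← @Nat.card_eq_fintype_card _ (Fintype.ofFinite _)]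
  refine Nat.card_congr
    { toFun := fun x => ⟨((x : {x : G // x ≠ 1}) : G), (generatingGraph_adj_iff hα hG).1 x.2⟩
      invFun := fun x => ⟨⟨⟨x, x.2.symm.ge (subset_closure (by simp))⟩, ?_⟩,
        (generatingGraph_adj_iff hα hG).2 x.2⟩
      left_inv := fun x => rfl
      right_inv := fun x => rfl }
  intro h
  have h1 : (x : Perm α) = 1 := congrArg Subtype.val h
  have h2 := x.2
  rw [h1, Set.pair_comm, closure_insert_one] at h2
  exact closure_singleton_ne_of_alternatingGroup_le hα hG (fun h' => g.2 (Subtype.ext h')) h2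

end Equiv.Perm

/-! ### Primitive subgroups containing g, and parity of the degree. -/

namespace Equiv.Perm

open MulAction Subgroup

theorem isPreprimitive_of_le {α : Type*} {K M : Subgroup (Perm α)} (h : K ≤ M)
    (hK : IsPreprimitive K α) : IsPreprimitive M α :=
  IsPreprimitive.of_surjective (φ := inclusion h) (f := ⟨id, fun _ _ => rfl⟩)
    Function.surjective_id

theorem isPreprimitive_map_subtype_iff {α : Type*} {G : Subgroup (Perm α)} (M : Subgroup G) :
    IsPreprimitive (M.map G.subtype) α ↔ IsPreprimitive M α :=
  (isPreprimitive_congr (φ := fun m : M => (⟨m, m, m.2, rfl⟩ : M.map G.subtype))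
    (f := ⟨id, fun _ _ => rfl⟩) (by rintro ⟨_, m, hm, rfl⟩; exact ⟨⟨m, hm⟩, rfl⟩)
    Function.bijective_id).symm

theorem sign_eq_one_of_odd_orderOf {α : Type*} [Fintype α] [DecidableEq α] {g : Perm α}
    (hg : Odd (orderOf g)) : sign g = 1 := by
  have h : sign g ^ orderOf g = 1 := by rw [← map_pow, pow_orderOf_eq_one, map_one]
  rcases Int.units_eq_one_or (sign g) with h1 | h1
  · exact h1
  · rw [h1, hg.neg_one_pow] at h
    exact absurd h (by decide)

variable {α : Type*} [Fintype α] [DecidableEq α]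

/-- If `g` lies in no maximal primitive subgroup of `G` other than the alternating group, then a
primitive subgroup of `G` containing `g` is `G` or is contained in the alternating group. -/
theorem eq_or_le_alternatingGroup_of_isPreprimitive {G : Subgroup (Perm α)} {g : G}
    (hg : ∀ M : Subgroup G, IsMaximalPrimitive G M →
      M.map G.subtype ≠ alternatingGroup α → g ∉ M)
    {K : Subgroup (Perm α)} (hKG : K ≤ G) (hgK : (g : Perm α) ∈ K) (hK : IsPreprimitive K α) :
    K = G ∨ G ≠ alternatingGroup α ∧ K ≤ alternatingGroup α := by
  rcases eq_top_or_exists_le_coatom (K.subgroupOf G) with h | ⟨M, hM, hKM⟩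
  · exact Or.inl (le_antisymm hKG (subgroupOf_eq_top.1 h))
  have hKM' : K ≤ M.map G.subtype := by
    have h := map_mono (f := G.subtype) hKM
    rwa [map_subgroupOf_eq_of_le hKG] at h
  have hMA : M.map G.subtype = alternatingGroup α := by
    by_contra h
    exact hg M ⟨hM, (isPreprimitive_map_subtype_iff M).1 (isPreprimitive_of_le hKM' hK)⟩ h
      (hKM (mem_subgroupOf.2 hgK))
  refine Or.inr ⟨fun h => hM.1 ?_, hMA ▸ hKM'⟩
  apply map_injective G.subtype_injective
  rw [hMA, ← h, ← MonoidHom.range_eq_map, range_subtype]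

theorem alternatingGroup_ne_top (hα : 1 < Fintype.card α) : alternatingGroup α ≠ ⊤ := by
  intro h
  obtain ⟨a, b, hab⟩ := Fintype.exists_pair_of_one_lt_card hα
  have h1 : swap a b ∈ alternatingGroup α := h ▸ mem_top _
  rw [mem_alternatingGroup, sign_swap hab] at h1
  exact absurd h1 (by decide)

theorem even_generatingDegree {G : Subgroup (Perm α)} (hα : 4 < Fintype.card α)
    (hG : G = alternatingGroup α ∨ G = ⊤) (g : {x : G // x ≠ 1})
    (hg : ∀ M : Subgroup G, IsMaximalPrimitive G M →
      M.map G.subtype ≠ alternatingGroup α → (g : G) ∉ M) :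
    Even (generatingDegree g) := by
  classical
  have hAG : alternatingGroup α ≤ G := by
    rcases hG with rfl | rfl
    exacts [le_rfl, le_top]
  have hnormal : G.Normal := by
    rcases hG with rfl | rfl <;> infer_instance
  have hprim : IsPreprimitive G α := by
    refine isPreprimitive_of_le hAG (alternatingGroup.isPreprimitive_of_three_le_card α ?_)
    rw [Nat.card_eq_fintype_card]
    omega
  have hg1 : ((g : G) : Perm α) ≠ 1 := fun h => g.2 (Subtype.ext h)
  rw [generatingDegree_eq_card (by omega) hAG, Nat.card_eq_fintype_card, Fintype.card_subtype]
  have hsub : ∀ x ∈ G, closure {((g : G) : Perm α), x} ≤ G := by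
    intro x hx
    rw [closure_le]
    rintro s (rfl | rfl)
    exacts [(g : G).2, hx]
  rcases hG with hG | hG
  · refine even_card_closure_pair_eq hα hAG hg1 (ε := 1) fun _ x => ⟨fun h => ⟨?_, isPreprimitive_of_le h.ge hprim⟩, ?_⟩
    · have : x ∈ G := h ▸ subset_closure (by simp)
      rwa [hG, mem_alternatingGroup] at this
    · rintro ⟨h1, h2⟩
      have hx : x ∈ G := by rwa [hG, mem_alternatingGroup]
      rcases eq_or_le_alternatingGroup_of_isPreprimitive hg (hsub x hx)
        (subset_closure (by simp)) h2 with h | h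
      · exact h
      · exact absurd hG h.1
  -- An element g of odd order is even, so x must be odd to generate Sym with g.
  · refine even_card_closure_pair_eq hα hAG hg1 (ε := -1)
      fun hodd x => ⟨fun h => ⟨?_, isPreprimitive_of_le h.ge hprim⟩, ?_⟩
    · refine (Int.units_eq_one_or _).resolve_left fun hx => ?_
      apply alternatingGroup_ne_top (α := α) (by omega)
      rw [eq_top_iff, ← hG, ← h, closure_le]
      rintro s (rfl | rfl)
      exacts [mem_alternatingGroup.2 (sign_eq_one_of_odd_orderOf hodd), mem_alternatingGroup.2 hx]
    · rintro ⟨h1, h2⟩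
      rcases eq_or_le_alternatingGroup_of_isPreprimitive hg (hsub x (hG ▸ mem_top x))
        (subset_closure (by simp)) h2 with h | h
      · exact h
      · have hx : x ∈ alternatingGroup α := h.2 (subset_closure (by simp))
        rw [mem_alternatingGroup, h1] at hx
        exact absurd hx (by decide)

end Equiv.Perm

/-! ### Eulerian circuits. -/

namespace SimpleGraph

variable {V : Type*} {Γ : SimpleGraph V}

theorem Walk.mem_support_of_reachable {u v : V} {p : Γ.Walk u v}
    (hp : ∀ x ∈ p.support, ∀ y, Γ.Adj x y → s(x, y) ∈ p.edges) {x y : V} (hx : x ∈ p.support)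
    (h : Γ.Reachable x y) : y ∈ p.support := by
  obtain ⟨q⟩ := h
  induction q with
  | nil => exact hx
  | cons hadj q ih => exact ih (p.snd_mem_support_of_mem_edges (hp _ hx _ hadj))

-- The trail uses all edges at its start u, an even number; a trail with distinct ends uses an odd
-- number of edges at each end.
open Classical in
theorem Walk.IsTrail.eq_of_forall_adj_mem_edges [Fintype V] {u v : V} {p : Γ.Walk u v}
    (hp : p.IsTrail) (hdeg : Even (Γ.degree u)) (h : ∀ w, Γ.Adj u w → s(u, w) ∈ p.edges) :
    u = v := by
  have h1 : p.edges.countP (fun e => u ∈ e) = Γ.degree u := by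
    rw [← Multiset.coe_countP, Multiset.countP_eq_card_filter, ← card_incidenceFinset_eq_degree]
    change Finset.card (hp.edgesFinset.filter (u ∈ ·)) = _
    congr 1
    ext e
    rw [Finset.mem_filter, mem_incidenceFinset]
    constructor
    · rintro ⟨h1, h2⟩
      exact ⟨p.edges_subset_edgeSet h1, h2⟩
    · rintro ⟨h1, h2⟩
      refine ⟨?_, h2⟩
      obtain ⟨w, rfl⟩ := Sym2.mem_iff_exists.1 h2
      exact h w h1
  have h2 := (hp.even_countP_edges_iff u).1 (h1 ▸ hdeg)
  by_contra hne
  exact (h2 hne).1 rfl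

open Classical in
/-- **Euler's theorem**: a finite graph all of whose degrees are even and all of whose edges lie
in one connected component has an Eulerian circuit. -/
theorem isEulerianGraph_of_even_degree [Fintype V] [Nonempty V]
    (hdeg : ∀ v, Even (Γ.degree v))
    (hconn : ∀ a b c d, Γ.Adj a b → Γ.Adj c d → Γ.Reachable a c) : IsEulerianGraph Γ := by
  by_cases hE : ∃ a b, Γ.Adj a b
  swap
  · push Not at hE
    refine ⟨Classical.arbitrary V, Walk.nil, fun e => ?_⟩
    induction e with
    | h a b => exact fun h => absurd h (hE a b)
  obtain ⟨a, b, hab⟩ := hE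
  let T : Set ℕ := {m | ∃ (u v : V) (p : Γ.Walk u v), p.IsTrail ∧ p.length = m}
  have hT : T.Finite := by
    refine (Set.finite_Iic Γ.edgeFinset.card).subset ?_
    rintro m ⟨u, v, p, hp, rfl⟩
    exact hp.length_le_card_edgeFinset
  have h1T : 1 ∈ T := ⟨a, b, hab.toWalk, by simp [Walk.isTrail_def], by simp⟩
  obtain ⟨m, ⟨u, v, p, hp, rfl⟩, hmax⟩ := Set.exists_max_image T id hT ⟨1, h1T⟩
  -- A longest trail uses every edge at its start. Once it is closed, this applies to all its
  -- rotations, hence to every vertex on it.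
  have hext : ∀ {x y : V} (q : Γ.Walk x y), q.IsTrail → q.length = p.length →
      ∀ w, Γ.Adj x w → s(x, w) ∈ q.edges := by
    intro x y q hq hlen w hw
    by_contra hcon
    have h2 : (Walk.cons hw.symm q).IsTrail := by
      rw [Walk.isTrail_cons]
      exact ⟨hq, by rwa [Sym2.eq_swap]⟩
    have h3 := hmax _ ⟨_, _, _, h2, rfl⟩
    simp only [id, Walk.length_cons] at h3
    omega
  obtain rfl : u = v := hp.eq_of_forall_adj_mem_edges (hdeg u) (hext p hp rfl)
  have hall : ∀ x ∈ p.support, ∀ y, Γ.Adj x y → s(x, y) ∈ p.edges := by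
    intro x hx y hxy
    have h2 := hext (p.rotate x hx) (hp.rotate hx) (p.length_rotate x hx) y hxy
    exact (p.rotate_edges x hx).mem_iff.1 h2
  obtain ⟨w, hw⟩ : ∃ w, Γ.Adj u w := by
    cases p with
    | nil =>
      have := hmax 1 h1T
      simp at this
    | cons h q => exact ⟨_, h⟩
  refine ⟨u, p, hp.isEulerian_of_forall_mem fun e => ?_⟩
  induction e with
  | h c d =>
    intro hcd
    have hc := Walk.mem_support_of_reachable hall p.start_mem_support (hconn u w c d hw hcd)
    exact hall c hc d hcd

end SimpleGraph

/-! ### All edges lie in one component. -/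

namespace Equiv.Perm

open MulAction Subgroup

variable {α : Type*} [Fintype α] [DecidableEq α]

/-- These are the hubs; a = b is allowed and gives an (n-1)-cycle. -/
theorem exists_isCycleOn_compl_pair (hα : 4 < Fintype.card α) (a b : α) :
    ∃ s : Perm α, s.IsCycleOn (({a, b}ᶜ : Finset α) : Set α) ∧ s.support = {a, b}ᶜ ∧
      sign s = -(-1) ^ ({a, b}ᶜ : Finset α).card := by
  obtain ⟨s, hs, hsupp⟩ := Finset.exists_cycleOn ({a, b}ᶜ : Finset α)
  have hnt : (({a, b}ᶜ : Finset α) : Set α).Nontrivial := by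
    rw [Finset.nontrivial_coe, ← Finset.one_lt_card_iff_nontrivial, Finset.card_compl]
    have := Finset.card_le_two (a := a) (b := b)
    omega
  have heq : s.support = {a, b}ᶜ :=
    Finset.Subset.antisymm hsupp fun x hx => mem_support.2 (hs.apply_ne hnt hx)
  have hcyc : s.IsCycle := isCycle_iff_exists_isCycleOn.2
    ⟨_, hnt, hs, fun x hx => hsupp (mem_support.2 hx)⟩
  exact ⟨s, hs, heq, by rw [hcyc.sign, heq]⟩

/-- A block containing the fixed point a is s-invariant. If it meets the cycle it contains at least
n-1 points, so it is everything; otherwise it lies in {a, b}, and for odd n it cannot have two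
points. -/
theorem isPreprimitive_of_isCycleOn_compl_pair (hα : 4 < Fintype.card α) {a b : α}
    (hab : a = b ∨ Odd (Fintype.card α)) {s : Perm α}
    (hs : s.IsCycleOn (({a, b}ᶜ : Finset α) : Set α)) (hsupp : s.support = {a, b}ᶜ)
    {g : Perm α} (ha : g a ≠ a) (hb : g b ≠ b) (hsw : ¬ (g a = b ∧ g b = a)) :
    IsPreprimitive (closure {g, s}) α := by
  have hcard : Fintype.card α - 2 ≤ ({a, b}ᶜ : Finset α).card := by
    rw [Finset.card_compl]
    have := Finset.card_le_two (a := a) (b := b)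
    omega
  set K := closure {g, s} with hK
  have hgK : g ∈ K := subset_closure (by simp)
  have hsK : s ∈ K := subset_closure (by simp)
  have hsa : s a = a := by
    rw [← notMem_support, hsupp]
    simp
  have hmem : ∀ x, x ∈ ({a, b}ᶜ : Finset α) ↔ x ≠ a ∧ x ≠ b := by
    intro x
    simp
  obtain ⟨c, hc⟩ : ({a, b}ᶜ : Finset α).Nonempty := by
    rw [← Finset.card_pos]
    omega
  have hS : ∀ x ∈ ({a, b}ᶜ : Finset α), x ∈ orbit K c := fun x hx =>
    SameCycle.mem_orbit hsK (hs.2 hc hx)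
  have hback : ∀ x, g x ∈ orbit K c → x ∈ orbit K c := by
    intro x hx
    rw [← orbit_eq_iff.2 hx]
    exact mem_orbit_symm.1 ⟨⟨g, hgK⟩, rfl⟩
  have hac : a ∈ orbit K c := by
    apply hback
    by_cases h : g a = b
    · rw [h]
      apply hback
      exact hS _ ((hmem _).2 ⟨fun h' => hsw ⟨h, h'⟩, hb⟩)
    · exact hS _ ((hmem _).2 ⟨ha, h⟩)
  have hbc : b ∈ orbit K c := by
    apply hback
    by_cases h : g b = a
    · rwa [h]
    · exact hS _ ((hmem _).2 ⟨h, hb⟩)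
  have htr : IsPretransitive K α := by
    rw [isPretransitive_iff_orbit_eq_univ c, Set.eq_univ_iff_forall]
    intro x
    by_cases hx : x ∈ ({a, b}ᶜ : Finset α)
    · exact hS x hx
    · rw [hmem, not_and_or, not_not, not_not] at hx
      rcases hx with rfl | rfl
      exacts [hac, hbc]
  refine IsPreprimitive.of_isTrivialBlock_base a fun {B} haB hB => ?_
  have hsB : s • B = B := isBlock_iff_of_mem.1 hB s hsK a haB (hsa.symm ▸ haB)
  by_cases hd : ∃ d ∈ B, d ∈ ({a, b}ᶜ : Finset α)
  · obtain ⟨d, hdB, hdS⟩ := hd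
    refine Or.inr (hB.eq_univ_of_card_lt ?_)
    have hsub : ((insert a ({a, b}ᶜ : Finset α) : Finset α) : Set α) ⊆ B := by
      intro x hx
      rw [Finset.coe_insert] at hx
      rcases hx with rfl | hx
      · exact haB
      · obtain ⟨k, rfl⟩ := hs.2 hdS hx
        have hk : s ^ k • B = B := (stabilizer (Perm α) B).zpow_mem hsB k
        rw [← hk]
        exact Set.smul_mem_smul_set hdB
    have h1 := Set.ncard_le_ncard hsub (Set.toFinite _)
    rw [Set.ncard_coe_finset, Finset.card_insert_of_notMem (by simp)] at h1
    rw [Nat.card_eq_fintype_card]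
    omega
  · push Not at hd
    left
    have hsub : B ⊆ {a, b} := by
      intro x hx
      have := hd x hx
      rw [hmem, not_and_or, not_not, not_not] at this
      exact this
    rcases hab with rfl | hodd
    · rw [Set.pair_eq_singleton] at hsub
      exact Set.subsingleton_singleton.anti hsub
    · have h1 := Set.ncard_le_ncard hsub (Set.toFinite _)
      have h2 := h1.trans ((Set.ncard_insert_le a {b}).trans_eq (by rw [Set.ncard_singleton]))
      rw [← Set.ncard_le_one_iff_subsingleton]
      have h3 := hB.ncard_dvd_card ⟨a, haB⟩
      rw [Nat.card_eq_fintype_card] at h3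
      by_contra h4
      have h5 : B.ncard = 2 := by omega
      rw [h5] at h3
      exact (Nat.not_even_iff_odd.2 hodd) (even_iff_two_dvd.2 h3)

/-- An even permutation is not a single transposition: a 2-cycle leaves another moved point, and a
longer cycle gives x and g x. -/
theorem exists_moved_pair_of_sign_eq_one {g : Perm α} (hg1 : g ≠ 1) (hg : sign g = 1) :
    ∃ a b, a ≠ b ∧ g a ≠ a ∧ g b ≠ b ∧ ¬ (g a = b ∧ g b = a) := by
  obtain ⟨x, hx⟩ : ∃ x, g x ≠ x := by
    by_contra! h
    exact hg1 (Equiv.ext h)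
  by_cases hgg : g (g x) = x
  · obtain ⟨y, hy⟩ : ∃ y, g y ≠ swap x (g x) y := by
      by_contra! h
      rw [Equiv.ext h, sign_swap hx.symm] at hg
      exact absurd hg (by decide)
    have hyx : y ≠ x := by
      rintro rfl
      exact hy (by rw [swap_apply_left])
    have hyg : y ≠ g x := by
      rintro rfl
      exact hy (by rw [swap_apply_right, hgg])
    rw [swap_apply_of_ne_of_ne hyx hyg] at hy
    exact ⟨x, y, hyx.symm, hx, hy, fun h => hyg h.1.symm⟩
  · exact ⟨x, g x, hx.symm, hx, fun h => hx (g.injective h), fun h => hgg h.2⟩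

theorem IsCycleOn.not_swaps (hα : 4 < Fintype.card α) {a b c d : α} {s : Perm α}
    (hs : s.IsCycleOn (({c, d}ᶜ : Finset α) : Set α)) (ha : a ∈ ({c, d}ᶜ : Finset α)) :
    ¬ (s a = b ∧ s b = a) := by
  rintro ⟨h1, h2⟩
  obtain ⟨e, -, he⟩ := Finset.exists_mem_notMem_of_card_lt_card
    (s := ({a, b, c, d} : Finset α)) (t := Finset.univ)
    (Finset.card_le_four.trans_lt (by rwa [Finset.card_univ]))
  simp only [Finset.mem_insert, Finset.mem_singleton, not_or] at he
  obtain ⟨k, hk⟩ := hs.2 ha (show e ∈ (({c, d}ᶜ : Finset α) : Set α) by simp [he])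
  rcases zpow_apply_eq_of_apply_apply_eq_self (f := s) (x := a) (by rw [h1, h2]) k with h | h
  · exact he.1 (by rw [← hk, h])
  · exact he.2.1 (by rw [← hk, h, h1])

theorem closure_pair_eq_alternatingGroup (hα : 4 < Fintype.card α)
    (H : ∀ K : Subgroup (Perm α), IsPreprimitive K α → K = ⊤ ∨ K = alternatingGroup α)
    {x y : Perm α} (hx : sign x = 1) (hy : sign y = 1)
    (h : IsPreprimitive (closure {x, y}) α) : closure {x, y} = alternatingGroup α := by
  refine (H _ h).resolve_left fun htop => alternatingGroup_ne_top (α := α) (by omega) ?_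
  rw [eq_top_iff, ← htop, closure_le]
  rintro s (rfl | rfl)
  exacts [mem_alternatingGroup.2 hx, mem_alternatingGroup.2 hy]

theorem closure_pair_eq_top
    (H : ∀ K : Subgroup (Perm α), IsPreprimitive K α → K = ⊤ ∨ K = alternatingGroup α)
    {x y : Perm α} (hx : sign x ≠ 1)
    (h : IsPreprimitive (closure {x, y}) α) : closure {x, y} = ⊤ := by
  refine (H _ h).resolve_right fun hA => hx ?_
  rw [← mem_alternatingGroup, ← hA]
  exact subset_closure (by simp)

/-- Every edge has an odd end, an odd element is adjacent to the (n-1)-cycle omitting any point it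
moves, and transpositions link these cycles. -/
theorem exists_reachable_of_adj_top (hα : 4 < Fintype.card α)
    (H : ∀ K : Subgroup (Perm α), IsPreprimitive K α → K = ⊤ ∨ K = alternatingGroup α) :
    ∃ v : {x : (⊤ : Subgroup (Perm α)) // x ≠ 1}, ∀ x y,
      (generatingGraph (⊤ : Subgroup (Perm α))).Adj x y →
      (generatingGraph (⊤ : Subgroup (Perm α))).Reachable x v := by
  have hadj {x y : {x : (⊤ : Subgroup (Perm α)) // x ≠ 1}} :=
    generatingGraph_adj_iff (x := x) (y := y) (by omega) (le_top (a := alternatingGroup α))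
  choose s hs hsupp _ using fun a : α => exists_isCycleOn_compl_pair hα a a
  have hs1 : ∀ a, s a ≠ 1 := by
    intro a h
    have h1 := hsupp a
    rw [h, support_one, eq_comm, ← Finset.card_eq_zero, Finset.card_compl] at h1
    have := Finset.card_le_two (a := a) (b := a)
    omega
  let v : α → {x : (⊤ : Subgroup (Perm α)) // x ≠ 1} := fun a =>
    ⟨⟨s a, mem_top _⟩, fun h => hs1 a (congrArg Subtype.val h)⟩
  have hub : ∀ (x : {x : (⊤ : Subgroup (Perm α)) // x ≠ 1}) (a : α),
      sign ((x : (⊤ : Subgroup (Perm α))) : Perm α) ≠ 1 →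
      ((x : (⊤ : Subgroup (Perm α))) : Perm α) a ≠ a →
      (generatingGraph (⊤ : Subgroup (Perm α))).Adj x (v a) := fun x a hx ha =>
    hadj.2 (closure_pair_eq_top H hx (isPreprimitive_of_isCycleOn_compl_pair hα (Or.inl rfl)
      (hs a) (hsupp a) ha ha fun h => ha h.1))
  have hvv : ∀ a b, (generatingGraph (⊤ : Subgroup (Perm α))).Reachable (v a) (v b) := by
    intro a b
    by_cases hab : a = b
    · rw [hab]
    let x : {x : (⊤ : Subgroup (Perm α)) // x ≠ 1} :=
      ⟨⟨swap a b, mem_top _⟩, fun h => hab (swap_eq_one_iff.1 (congrArg Subtype.val h))⟩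
    have hsx : sign (swap a b) ≠ 1 := by
      rw [sign_swap hab]
      decide
    exact (hub x a hsx (by simpa [x] using Ne.symm hab)).symm.reachable.trans
      (hub x b hsx (by simpa [x] using hab)).reachable
  have : Nonempty α := Fintype.card_pos_iff.1 (by omega)
  let a₀ : α := Classical.arbitrary α
  have hodd : ∀ x : {x : (⊤ : Subgroup (Perm α)) // x ≠ 1},
      sign ((x : (⊤ : Subgroup (Perm α))) : Perm α) ≠ 1 →
      (generatingGraph (⊤ : Subgroup (Perm α))).Reachable x (v a₀) := by
    intro x hx
    obtain ⟨a, ha⟩ : ∃ a, ((x : (⊤ : Subgroup (Perm α))) : Perm α) a ≠ a := by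
      by_contra! h
      exact x.2 (Subtype.ext (Equiv.ext h))
    exact (hub x a hx ha).reachable.trans (hvv a a₀)
  refine ⟨v a₀, fun x y hxy => ?_⟩
  by_cases hx : sign ((x : (⊤ : Subgroup (Perm α))) : Perm α) = 1
  · by_cases hy : sign ((y : (⊤ : Subgroup (Perm α))) : Perm α) = 1
    · exfalso
      apply alternatingGroup_ne_top (α := α) (by omega)
      rw [eq_top_iff, ← hadj.1 hxy, closure_le]
      rintro s (rfl | rfl)
      exacts [mem_alternatingGroup.2 hx, mem_alternatingGroup.2 hy]
    · exact hxy.reachable.trans (hodd y hy)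
  · exact hodd x hx

/-- The hubs must be even: (n-1)-cycles for even n, (n-2)-cycles for odd n. -/
theorem exists_reachable_alternatingGroup (hα : 4 < Fintype.card α)
    (H : ∀ K : Subgroup (Perm α), IsPreprimitive K α → K = ⊤ ∨ K = alternatingGroup α) :
    ∃ v : {x : alternatingGroup α // x ≠ 1}, ∀ x,
      (generatingGraph (alternatingGroup α)).Reachable x v := by
  have hadj {x y : {x : alternatingGroup α // x ≠ 1}} :=
    generatingGraph_adj_iff (x := x) (y := y) (by omega) (le_refl (alternatingGroup α))
  have hsign : ∀ x : {x : alternatingGroup α // x ≠ 1},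
      sign ((x : alternatingGroup α) : Perm α) = 1 := fun x => mem_alternatingGroup.1 x.1.2
  have hne1 : ∀ x : {x : alternatingGroup α // x ≠ 1},
      ((x : alternatingGroup α) : Perm α) ≠ 1 := fun x h => x.2 (Subtype.ext h)
  choose s hs hsupp hssign using fun a b : α => exists_isCycleOn_compl_pair hα a b
  have hs1 : ∀ a b, s a b ≠ 1 := by
    intro a b h
    have h1 := hsupp a b
    rw [h, support_one, eq_comm, ← Finset.card_eq_zero, Finset.card_compl] at h1
    have := Finset.card_le_two (a := a) (b := b)
    omega
  have hmoves : ∀ a b c, c ≠ a → c ≠ b → s a b c ≠ c := by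
    intro a b c h1 h2
    rw [← mem_support, hsupp]
    simp [h1, h2]
  rcases Nat.even_or_odd (Fintype.card α) with heven | hodd
  · have hs2 : ∀ a, sign (s a a) = 1 := by
      intro a
      rw [hssign, Finset.card_compl, Finset.pair_eq_singleton, Finset.card_singleton]
      obtain ⟨m, hm⟩ := heven
      rw [Odd.neg_one_pow ⟨m - 1, by omega⟩, neg_neg]
    let v : α → {x : alternatingGroup α // x ≠ 1} := fun a =>
      ⟨⟨s a a, mem_alternatingGroup.2 (hs2 a)⟩, fun h => hs1 a a (congrArg Subtype.val h)⟩
    have hub : ∀ (x : {x : alternatingGroup α // x ≠ 1}) (a : α),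
        ((x : alternatingGroup α) : Perm α) a ≠ a →
        (generatingGraph (alternatingGroup α)).Adj x (v a) := fun x a ha =>
      hadj.2 (closure_pair_eq_alternatingGroup hα H (hsign x) (hs2 a)
        (isPreprimitive_of_isCycleOn_compl_pair hα (Or.inl rfl)
          (hs a a) (hsupp a a) ha ha fun h => ha h.1))
    have : Nonempty α := Fintype.card_pos_iff.1 (by omega)
    refine ⟨v (Classical.arbitrary α), fun x => ?_⟩
    obtain ⟨a, ha⟩ : ∃ a, ((x : alternatingGroup α) : Perm α) a ≠ a := by
      by_contra! h
      exact hne1 x (Equiv.ext h)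
    refine (hub x a ha).reachable.trans ?_
    by_cases hab : a = Classical.arbitrary α
    · rw [hab]
    · exact (hub (v a) _ (hmoves _ _ _ (Ne.symm hab) (Ne.symm hab))).reachable
  · have hs2 : ∀ a b, a ≠ b → sign (s a b) = 1 := by
      intro a b hab
      rw [hssign, Finset.card_compl, Finset.card_pair hab]
      obtain ⟨m, hm⟩ := hodd
      rw [Odd.neg_one_pow ⟨m - 1, by omega⟩, neg_neg]
    let v : ∀ a b, a ≠ b → {x : alternatingGroup α // x ≠ 1} := fun a b hab =>
      ⟨⟨s a b, mem_alternatingGroup.2 (hs2 a b hab)⟩, fun h => hs1 a b (congrArg Subtype.val h)⟩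
    have hub : ∀ (x : {x : alternatingGroup α // x ≠ 1}) (a b : α) (hab : a ≠ b),
        ((x : alternatingGroup α) : Perm α) a ≠ a → ((x : alternatingGroup α) : Perm α) b ≠ b →
        ¬ (((x : alternatingGroup α) : Perm α) a = b ∧
          ((x : alternatingGroup α) : Perm α) b = a) →
        (generatingGraph (alternatingGroup α)).Adj x (v a b hab) := fun x a b hab ha hb h =>
      hadj.2 (closure_pair_eq_alternatingGroup hα H (hsign x) (hs2 a b hab)
        (isPreprimitive_of_isCycleOn_compl_pair hα (Or.inr hodd)
          (hs a b) (hsupp a b) ha hb h))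
    have hvv : ∀ a b c d (hab : a ≠ b) (hcd : c ≠ d), a ≠ c → a ≠ d → b ≠ c → b ≠ d →
        (generatingGraph (alternatingGroup α)).Adj (v a b hab) (v c d hcd) := by
      intro a b c d hab hcd h1 h2 h3 h4
      refine hub _ c d hcd (hmoves a b c h1.symm h3.symm) (hmoves a b d h2.symm h4.symm) ?_
      exact (hs a b).not_swaps hα (by simp [h1.symm, h3.symm])
    -- With n ≥ 5, two points remain outside, and their hub is adjacent to both given ones.
    have hreach3 : ∀ a b c d (hab : a ≠ b) (hcd : c ≠ d), ({a, b, c, d} : Finset α).card ≤ 3 →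
        (generatingGraph (alternatingGroup α)).Reachable (v a b hab) (v c d hcd) := by
      intro a b c d hab hcd h
      have h1 : 1 < ({a, b, c, d}ᶜ : Finset α).card := by
        rw [Finset.card_compl]
        omega
      obtain ⟨e, he, f, hf, hef⟩ := Finset.one_lt_card.1 h1
      simp only [Finset.mem_compl, Finset.mem_insert, Finset.mem_singleton, not_or] at he hf
      exact (hvv a b e f hab hef (Ne.symm he.1) (Ne.symm hf.1) (Ne.symm he.2.1)
        (Ne.symm hf.2.1)).reachable.trans
        (hvv e f c d hef hcd he.2.2.1 he.2.2.2 hf.2.2.1 hf.2.2.2).reachable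
    have hreach : ∀ a b c d (hab : a ≠ b) (hcd : c ≠ d),
        (generatingGraph (alternatingGroup α)).Reachable (v a b hab) (v c d hcd) := by
      intro a b c d hab hcd
      by_cases h : a ≠ c ∧ a ≠ d ∧ b ≠ c ∧ b ≠ d
      · exact (hvv a b c d hab hcd h.1 h.2.1 h.2.2.1 h.2.2.2).reachable
      · refine hreach3 a b c d hab hcd ?_
        have h1 : a = c ∨ a = d ∨ b = c ∨ b = d := by tauto
        rcases h1 with rfl | rfl | rfl | rfl
        · refine (Finset.card_le_card (t := {a, b, d}) ?_).trans Finset.card_le_three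
          intro x; simp; tauto
        · refine (Finset.card_le_card (t := {a, b, c}) ?_).trans Finset.card_le_three
          intro x; simp; tauto
        · refine (Finset.card_le_card (t := {a, b, d}) ?_).trans Finset.card_le_three
          intro x; simp
        · refine (Finset.card_le_card (t := {a, b, c}) ?_).trans Finset.card_le_three
          intro x; simp; tauto
    obtain ⟨a₀, b₀, hab₀⟩ := Fintype.exists_pair_of_one_lt_card (α := α) (by omega)
    refine ⟨v a₀ b₀ hab₀, fun x => ?_⟩
    obtain ⟨a, b, hab, ha, hb, hsw⟩ := exists_moved_pair_of_sign_eq_one (hne1 x) (hsign x)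
    exact (hub x a b hab ha hb hsw).reachable.trans (hreach a b a₀ b₀ hab hab₀)

open Classical in
theorem isEulerianGraph_generatingGraph {G : Subgroup (Perm α)} (hα : 4 < Fintype.card α)
    (hG : G = alternatingGroup α ∨ G = ⊤)
    (H : ∀ K : Subgroup (Perm α), IsPreprimitive K α → K = ⊤ ∨ K = alternatingGroup α)
    (heven : ∀ g : {x : G // x ≠ 1}, Even (generatingDegree g)) :
    IsEulerianGraph (generatingGraph G) := by
  obtain ⟨v, hv⟩ : ∃ v : {x : G // x ≠ 1}, ∀ x y, (generatingGraph G).Adj x y →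
      (generatingGraph G).Reachable x v := by
    rcases hG with rfl | rfl
    · obtain ⟨v, hv⟩ := exists_reachable_alternatingGroup hα H
      exact ⟨v, fun x _ _ => hv x⟩
    · exact exists_reachable_of_adj_top hα H
  have : Nonempty {x : G // x ≠ 1} := ⟨v⟩
  have := Fintype.ofFinite {x : G // x ≠ 1}
  refine SimpleGraph.isEulerianGraph_of_even_degree (fun g => ?_)
    fun a b c d hab hcd => (hv a b hab).trans (hv c d hcd).symm
  convert heven g using 1
  unfold generatingDegree
  congr!

end Equiv.Perm

end

theorem theoremt (n : ℕ) (hn : 4 < n) (G : Subgroup (Equiv.Perm (Fin n)))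
    (hG : G = alternatingGroup (Fin n) ∨ G = ⊤) :
    (∀ g : {x : G // x ≠ 1},
      (∀ M : Subgroup G, IsMaximalPrimitive G M →
        M.map G.subtype ≠ alternatingGroup (Fin n) → (g : G) ∉ M) →
      Even (generatingDegree g)) ∧
    ((∀ H : Subgroup (Equiv.Perm (Fin n)), MulAction.IsPreprimitive H (Fin n) →
        H = ⊤ ∨ H = alternatingGroup (Fin n)) →
      (∀ g : {x : G // x ≠ 1}, Even (generatingDegree g)) ∧
        IsEulerianGraph (generatingGraph G)) := by
  have hα : 4 < Fintype.card (Fin n) := by rwa [Fintype.card_fin]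
  refine ⟨fun g hg => Equiv.Perm.even_generatingDegree hα hG g hg, fun H => ?_⟩
  have heven : ∀ g : {x : G // x ≠ 1}, Even (generatingDegree g) := by
    -- The condition is vacuous: a maximal primitive M other than Alt would be all of Sym, hence not
    -- proper in G.
    refine fun g => Equiv.Perm.even_generatingDegree hα hG g fun M hM hMA => ?_
    have hprim := (Equiv.Perm.isPreprimitive_map_subtype_iff M).2 hM.2
    have htop : M.map G.subtype = ⊤ := (H _ hprim).resolve_right hMA
    refine absurd ?_ hM.1.1
    have hGtop : G = ⊤ := top_le_iff.1 (htop ▸ Subgroup.map_subtype_le M)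
    apply Subgroup.map_injective G.subtype_injective
    rw [htop, ← MonoidHom.range_eq_map, Subgroup.range_subtype, hGtop]
  exact ⟨heven, Equiv.Perm.isEulerianGraph_generatingGraph hα hG H heven⟩
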